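/- Let $n\ge 1$, and let $T=\{(i,j): 1\le i<j\le n\}$. A vector $v=(v_{ij})_{(i,j)\in T}\in\mathbb N^T$ (with $0\in\mathbb N$) is called admitted if $v_{i,i+1}=0$ for $1\le i<n$ and $v_{ij}+v_{jk}\le v_{ik}\le v_{ij}+v_{jk}+1$ for all $1\le i<j<k\le n$; the set of admitted vectors is ordered componentwise. Let $\tilde S_n$ be the affine symmetric group: the group, under composition, of the permutations $f$ of $\mathbb Z$ such that $f(x+n)=f(x)+n$ for all $x\in\mathbb Z$ and $f(1)+\cdots+f(n)=n(n+1)/2$. Such an $f$ is identified with its window $[f(1),\dots,f(n)]$. For $n\ge2$ and $k=0,\dots,n-1$, let $s_k\in\tilde S_n$ be the element that sends $x$ to $x+1$ if $x\equiv k\pmod n$, sends $x$ to $x-1$ if $x\equiv k+1\pmod n$, and fixes every other integer $x$ (for $n=1$ the group is trivial, and the set of generators is taken to be empty). The Coxeter length $\ell(f)$ is the least $m$ such that $f$ is a product of $m$ of the elements $s_0,\dots,s_{n-1}$. The left weak order on $\tilde S_n$ is the reflexive and transitive closure of the relation: $g=s_kf$ for some $k$, and $\ell(g)=\ell(f)+1$.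 **Theorem.** There is an element $f_c\in\tilde S_n$ with window $[c_1,\dots,c_n]$, where $c_1=-n(n-3)/2$ and $c_{i+1}=c_i+n-1$ for $1\le i<n$. The map $v\mapsto F(v)=[a_1,\dots,a_n]$ defined by $$a_i=i+\sum_{p<i}v_{pi}-\sum_{i<p}v_{ip}\qquad(1\le i\le n)$$ sends each admitted vector to the window of an element of $\tilde S_n$, and it is an isomorphism of posets from the set of admitted vectors onto the interval $[\mathrm{id},f_c]$ of $\tilde S_n$ with the left weak order. Moreover, $v\mapsto\ell(F(v))$ is the rank function of the poset of admitted vectors: it is $0$ on the minimal elements, and $\ell(F(v'))=\ell(F(v))+1$ whenever $v'$ covers $v$. This rank function is $\ell(F(v))=\sum_{1\le i<j\le n}v_{ij}$. -/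

import Mathlib

open Finset

/-- The index set `{(i, j) : 1 ≤ i < j ≤ n}`; the element `i : Fin n` stands for the
integer `i + 1` of `{1, …, n}`. -/
abbrev PairIndex (n : ℕ) : Type := {p : Fin n × Fin n // p.1 < p.2}

/-- The coordinate `v_{ij}` of `v ∈ ℕ^T`, where `i < j`. -/
def coord {n : ℕ} (v : PairIndex n → ℕ) (i j : Fin n) (h : i < j) : ℕ := v ⟨(i, j), h⟩

/-- Admitted vectors: `v_{i,i+1} = 0` and `v_{ij} + v_{jk} ≤ v_{ik} ≤ v_{ij} + v_{jk} + 1`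
for `i < j < k`. -/
def IsAdmitted {n : ℕ} (v : PairIndex n → ℕ) : Prop :=
  (∀ (i j : Fin n) (h : i < j), (j : ℕ) = (i : ℕ) + 1 → coord v i j h = 0) ∧
  (∀ (i j k : Fin n) (hij : i < j) (hjk : j < k),
    coord v i j hij + coord v j k hjk ≤ coord v i k (hij.trans hjk) ∧
    coord v i k (hij.trans hjk) ≤ coord v i j hij + coord v j k hjk + 1)

/-- The poset of admitted vectors, with the componentwise order inherited from `ℕ^T`. -/
abbrev AdmittedVector (n : ℕ) : Type := {v : PairIndex n → ℕ // IsAdmitted v}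

/-- The map `F(v)_i = i + ∑_{p<i} v_{pi} - ∑_{i<p} v_{ip}`, with values in `ℤ^n`. -/
def windowMap {n : ℕ} (v : PairIndex n → ℕ) : Fin n → ℤ := fun i =>
  ((i : ℤ) + 1) + ∑ p : {p : Fin n // p < i}, (coord v p.1 i p.2 : ℤ)
    - ∑ p : {p : Fin n // i < p}, (coord v i p.1 p.2 : ℤ)

theorem periodic_add_mul {n : ℕ} {f : Equiv.Perm ℤ} (hf : ∀ x, f (x + n) = f x + n)
    (x k : ℤ) : f (x + k * n) = f x + k * n := by
  induction k using Int.induction_on with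
  | zero => simp
  | succ k ih =>
    have : x + ((k : ℤ) + 1) * n = (x + k * n) + n := by ring
    rw [this, hf, ih]; ring
  | pred k ih =>
    have h := hf (x + (-(k : ℤ) - 1) * n)
    have e : x + (-(k : ℤ) - 1) * n + n = x + -(k : ℤ) * n := by ring
    rw [e, ih] at h
    linarith

theorem periodic_symm {n : ℕ} {f : Equiv.Perm ℤ} (hf : ∀ x, f (x + n) = f x + n)
    (x : ℤ) : f.symm (x + n) = f.symm x + n := by
  apply f.injective
  rw [hf]; simp

theorem sum_comp_periodic {n : ℕ} {g : Equiv.Perm ℤ} (hg : ∀ x, g (x + n) = g x + n)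
    (d : ℤ → ℤ) (hd : ∀ x k : ℤ, d (x + k * n) = d x) :
    ∑ x ∈ Icc (1 : ℤ) n, d (g x) = ∑ x ∈ Icc (1 : ℤ) n, d x := by
  rcases Nat.eq_zero_or_pos n with rfl | hn
  · simp
  have hn' : (0 : ℤ) < n := by exact_mod_cast hn
  set r : ℤ → ℤ := fun x => (g x - 1) % n + 1 with hr
  have hmaps : Set.MapsTo r (Icc (1 : ℤ) n : Finset ℤ) (Icc (1 : ℤ) n : Finset ℤ) := by
    intro x _
    have h1 := Int.emod_nonneg (g x - 1) hn'.ne'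
    have h2 := Int.emod_lt_of_pos (g x - 1) hn'
    simp only [coe_Icc, Set.mem_Icc, hr]
    constructor <;> linarith
  have hinj : Set.InjOn r (Icc (1 : ℤ) n : Finset ℤ) := by
    intro x hx y hy hxy
    simp only [coe_Icc, Set.mem_Icc] at hx hy
    have h : (g x - 1) % n = (g y - 1) % n := by simpa [hr] using hxy
    obtain ⟨k, hk⟩ := Int.ModEq.dvd (show (g y - 1) ≡ (g x - 1) [ZMOD n] from h.symm)
    have hgx : g x = g (y + k * n) := by rw [periodic_add_mul hg]; linarith
    have hxk := g.injective hgx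
    have : k = 0 := by
      by_contra hk0
      rcases lt_or_gt_of_ne hk0 with h0 | h0
      · nlinarith
      · nlinarith
    simpa [this] using hxk
  refine Finset.sum_nbij r hmaps hinj
    (Finset.surjOn_of_injOn_of_card_le r hmaps hinj le_rfl) ?_
  intro x _
  have h := Int.emod_add_mul_ediv (g x - 1) n
  have : g x = r x + ((g x - 1) / n) * n := by
    simp only [hr]; linarith
  rw [this, hd]

theorem mul_sum_eq {n : ℕ} {f g : Equiv.Perm ℤ} (hf : ∀ x, f (x + n) = f x + n)
    (hg : ∀ x, g (x + n) = g x + n) :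
    ∑ x ∈ Icc (1 : ℤ) n, (f * g) x =
      ∑ x ∈ Icc (1 : ℤ) n, f x + ∑ x ∈ Icc (1 : ℤ) n, g x - ∑ x ∈ Icc (1 : ℤ) n, x := by
  have h := sum_comp_periodic hg (fun x => f x - x) (by
    intro x k
    simp only [periodic_add_mul hf]; ring)
  simp only [sum_sub_distrib] at h
  simp only [Equiv.Perm.mul_apply]
  linarith

theorem sum_Icc_id (n : ℕ) : ∑ x ∈ Icc (1 : ℤ) n, x = (n : ℤ) * (n + 1) / 2 := by
  have h : ∀ m : ℕ, 2 * ∑ x ∈ Icc (1 : ℤ) m, x = (m : ℤ) * (m + 1) := by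
    intro m
    induction m with
    | zero => simp
    | succ m ih =>
      have e : Icc (1 : ℤ) ((m + 1 : ℕ) : ℤ) = insert ((m : ℤ) + 1) (Icc (1 : ℤ) m) := by
        ext x; simp only [mem_Icc, mem_insert]; push_cast; omega
      rw [e, sum_insert (by simp), mul_add, ih]; push_cast; ring
  have := h n
  omega

/-- The affine symmetric group `S̃_n`: the permutations `f` of `ℤ` with `f(x + n) = f(x) + n`
for all `x` and `f(1) + ⋯ + f(n) = n(n+1)/2`, under composition. -/
def affineSymmetricGroup (n : ℕ) : Subgroup (Equiv.Perm ℤ) where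
  carrier := {f | (∀ x, f (x + n) = f x + n) ∧
    ∑ x ∈ Icc (1 : ℤ) n, f x = (n : ℤ) * (n + 1) / 2}
  one_mem' := ⟨fun x => by simp, by simpa using sum_Icc_id n⟩
  mul_mem' := by
    rintro f g ⟨hf, hf'⟩ ⟨hg, hg'⟩
    refine ⟨fun x => by simp [hf, hg], ?_⟩
    rw [mul_sum_eq hf hg, hf', hg', sum_Icc_id]; ring
  inv_mem' := by
    rintro f ⟨hf, hf'⟩
    have hi : ∀ x, f⁻¹ (x + n) = f⁻¹ x + n := periodic_symm hf
    refine ⟨hi, ?_⟩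
    have h := mul_sum_eq hf hi
    rw [mul_inv_cancel, hf'] at h
    simp only [Equiv.Perm.one_apply] at h
    rw [sum_Icc_id] at h
    linarith

/-- The window `[f(1), …, f(n)]` of an affine permutation `f`. -/
def window {n : ℕ} (f : affineSymmetricGroup n) : Fin n → ℤ := fun i => f.1 ((i : ℤ) + 1)

/-- The function exchanging `k + mn` and `k + 1 + mn` for every integer `m`. -/
def adjSwapFun (n : ℕ) (k x : ℤ) : ℤ :=
  if (n : ℤ) ∣ x - k then x + 1 else if (n : ℤ) ∣ x - (k + 1) then x - 1 else x

theorem not_dvd_one_of_two_le {n : ℕ} (hn : 2 ≤ n) : ¬ (n : ℤ) ∣ 1 := by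
  intro h
  have := Int.le_of_dvd one_pos h
  omega

theorem adjSwapFun_involutive {n : ℕ} (hn : 2 ≤ n) (k : ℤ) :
    Function.Involutive (adjSwapFun n k) := by
  intro x
  have h1 := not_dvd_one_of_two_le hn
  unfold adjSwapFun
  by_cases ha : (n : ℤ) ∣ x - k
  · have hb : ¬ (n : ℤ) ∣ x + 1 - k := fun h => h1 (by
      have := dvd_sub h ha; ring_nf at this; simpa using this)
    simp [ha, hb]
  · by_cases hb : (n : ℤ) ∣ x - (k + 1)
    · have hc : (n : ℤ) ∣ x - 1 - k := by
        have e : x - 1 - k = x - (k + 1) := by ring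
        rw [e]; exact hb
      simp [ha, hb, hc]
    · simp [ha, hb]

theorem adjSwapFun_add (n : ℕ) (k x : ℤ) :
    adjSwapFun n k (x + n) = adjSwapFun n k x + n := by
  have e1 : (n : ℤ) ∣ x + n - k ↔ (n : ℤ) ∣ x - k := by
    rw [show x + n - k = (x - k) + n by ring]; exact dvd_add_self_right
  have e2 : (n : ℤ) ∣ x + n - (k + 1) ↔ (n : ℤ) ∣ x - (k + 1) := by
    rw [show x + n - (k + 1) = (x - (k + 1)) + n by ring]; exact dvd_add_self_right
  unfold adjSwapFun
  simp only [e1, e2]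
  split_ifs <;> ring

theorem sum_adjSwapFun {n : ℕ} (hn : 2 ≤ n) (k : ℤ) :
    ∑ x ∈ Icc (1 : ℤ) n, adjSwapFun n k x = (n : ℤ) * (n + 1) / 2 := by
  have h1 := not_dvd_one_of_two_le hn
  set e : ℤ → ℤ := fun x => if (n : ℤ) ∣ x - k then 1 else 0 with he
  have key : ∀ x, adjSwapFun n k x = x + e x - e (Equiv.addRight (-1 : ℤ) x) := by
    intro x
    have h3 : x + -1 - k = x - (k + 1) := by ring
    simp only [he, adjSwapFun, Equiv.coe_addRight, h3]
    by_cases ha : (n : ℤ) ∣ x - k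
    · have hb : ¬ (n : ℤ) ∣ x - (k + 1) := fun h => h1 (by
        have := dvd_sub ha h; ring_nf at this; simpa using this)
      simp [ha, hb]
    · by_cases hb : (n : ℤ) ∣ x - (k + 1) <;> simp [ha, hb]
  have hs := sum_comp_periodic (n := n) (g := Equiv.addRight (-1 : ℤ))
    (fun x => by simp; ring) e (fun x m => by
      have : (n : ℤ) ∣ x + m * n - k ↔ (n : ℤ) ∣ x - k := by
        rw [show x + m * n - k = (x - k) + m * n by ring]
        exact (dvd_add_left (Dvd.intro_left m rfl))
      simp only [he, this])
  simp only [key, sum_sub_distrib, sum_add_distrib, hs, sum_Icc_id]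
  ring

/-- The adjacent affine transposition `s_k`, for `k = 0, …, n - 1`: it exchanges `k` and `k + 1`
(and their translates by multiples of `n`). For `n ≤ 1` there is no such element, and the value
is the identity. -/
def adjSwap {n : ℕ} (k : Fin n) : affineSymmetricGroup n :=
  if hn : 2 ≤ n then
    ⟨(adjSwapFun_involutive hn (k : ℤ)).toPerm,
      fun x => adjSwapFun_add n k x, sum_adjSwapFun hn k⟩
  else 1

/-- The Coxeter length: the least length of a word in `s_0, …, s_{n-1}` with product `f`. -/
noncomputable def coxeterLength {n : ℕ} (f : affineSymmetricGroup n) : ℕ :=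
  sInf {m | ∃ w : List (Fin n), w.length = m ∧ (w.map adjSwap).prod = f}

/-- The covering relation of the left weak order. -/
def LeftWeakCovers {n : ℕ} (f g : affineSymmetricGroup n) : Prop :=
  (∃ k : Fin n, g = adjSwap k * f) ∧ coxeterLength g = coxeterLength f + 1

theorem length_le_of_reflTransGen {n : ℕ} {f g : affineSymmetricGroup n}
    (h : Relation.ReflTransGen LeftWeakCovers f g) :
    f = g ∨ coxeterLength f < coxeterLength g := by
  induction h with
  | refl => exact Or.inl rfl
  | tail _ hc ih =>
    right
    rcases ih with rfl | ih
    · rw [hc.2]; exact Nat.lt_succ_self _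
    · rw [hc.2]; exact ih.trans (Nat.lt_succ_self _)

/-- The left weak order on `S̃_n`: the reflexive and transitive closure of its covering
relation. -/
instance leftWeakOrder (n : ℕ) : PartialOrder (affineSymmetricGroup n) where
  le f g := Relation.ReflTransGen LeftWeakCovers f g
  le_refl _ := Relation.ReflTransGen.refl
  le_trans _ _ _ h h' := h.trans h'
  le_antisymm f g h h' := by
    rcases length_le_of_reflTransGen h with e | e
    · exact e
    · rcases length_le_of_reflTransGen h' with e' | e'
      · exact e'.symm
      · exact absurd e (not_lt.mpr e'.le)

/-- The sequence `c_1 = -n(n-3)/2`, `c_{i+1} = c_i + n - 1`, with indices shifted by one: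
`cSeq n i` is `c_{i+1}`. -/
def cSeq (n : ℕ) : ℕ → ℤ
  | 0 => -((n : ℤ) * ((n : ℤ) - 3) / 2)
  | i + 1 => cSeq n i + (n : ℤ) - 1

/-- `ρ` is the rank function of a (graded) poset: it vanishes on the minimal elements and
increases by one along every covering relation. -/
def IsRankFunction {P : Type*} [PartialOrder P] (ρ : P → ℕ) : Prop :=
  (∀ x, IsMin x → ρ x = 0) ∧ ∀ x y, x ⋖ y → ρ y = ρ x + 1

/-!
The affine permutation `f` is encoded by the coordinates `⌊(f(j) - f(i)) / n⌋` for `i < j`, which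
locate its alcove among the hyperplanes of the affine arrangement of type `A`; the distance
between `f` and `g` is the number of separating hyperplanes, that is, the `ℓ¹` distance of the
coordinate vectors. Left multiplication by `s_k` changes a single coordinate by `±1`, and if `f ≠ g`
then a descent of `g f⁻¹` yields an `s_k` that brings `f` closer to `g`. Hence `ℓ(g f⁻¹)` is this
distance, and `f ≤ g` in the left weak order if and only if every coordinate of `f` lies between `0`
and that of `g`.

The triangle inequalities characterize the coordinate matrices of alcoves, and the window is
recovered from the coordinates by column sums, which is the formula for `F(v)`. Admitted vectors are
therefore the nonnegative coordinate vectors that vanish at the pairs `(i, i + 1)`. By the triangle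
inequalities they are the ones below the greatest admitted vector `v_{ij} = j - i - 1`, whose window
is `[c_1, …, c_n]`.
-/

section Windows

variable {n : ℕ}

theorem eq_of_dvd_sub {i j : Fin n} (h : (n : ℤ) ∣ (i : ℤ) - j) : i = j := by
  have := Int.eq_zero_of_abs_lt_dvd h (by rw [abs_lt]; omega)
  exact Fin.ext (by omega)

theorem window_add_mul (f : affineSymmetricGroup n) (i : Fin n) (m : ℤ) :
    f.1 (m * n + i + 1) = window f i + m * n := by
  rw [window, ← periodic_add_mul f.2.1]
  ring_nf

theorem not_dvd_window_sub (f : affineSymmetricGroup n) {i j : Fin n} (hij : i ≠ j) :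
    ¬ (n : ℤ) ∣ window f j - window f i := by
  rintro ⟨m, hm⟩
  have h : f.1 (0 * n + j + 1) = f.1 (m * n + i + 1) := by
    simp only [window_add_mul]
    linarith
  exact hij.symm (eq_of_dvd_sub ⟨m, by linarith [f.1.injective h]⟩)

theorem sum_Icc_eq_sum_fin {M : Type*} [AddCommMonoid M] (f : ℤ → M) :
    ∑ x ∈ Icc (1 : ℤ) n, f x = ∑ i : Fin n, f ((i : ℤ) + 1) := by
  symm
  refine sum_bij (fun i _ => (i : ℤ) + 1) ?_ ?_ ?_ fun _ _ => rfl
  · intro i _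
    rw [mem_Icc]
    omega
  · intro i _ j _ h
    exact Fin.ext (by omega)
  · intro x hx
    rw [mem_Icc] at hx
    exact ⟨⟨(x - 1).toNat, by omega⟩, mem_univ _, by simp only; omega⟩

/-- The division of the positions `m n + i + 1` into translates of the window `{1, …, n}`. -/
def windowEquiv (n : ℕ) [NeZero n] : Fin n × ℤ ≃ ℤ :=
  ((Equiv.prodComm _ _).trans (Int.divModEquiv n).symm).trans (Equiv.addRight 1)

variable [NeZero n]

theorem windowEquiv_apply (i : Fin n) (m : ℤ) : windowEquiv n (i, m) = m * n + i + 1 := rfl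

theorem exists_eq_mul_add (x : ℤ) : ∃ (m : ℤ) (i : Fin n), x = m * n + i := by
  obtain ⟨⟨m, i⟩, rfl⟩ := (Int.divModEquiv n).symm.surjective x
  exact ⟨m, i, rfl⟩

theorem exists_window_eq (f : affineSymmetricGroup n) (y : ℤ) :
    ∃ (i : Fin n) (m : ℤ), f.1 (m * n + i + 1) = y := by
  obtain ⟨⟨i, m⟩, h⟩ := ((windowEquiv n).trans f.1).surjective y
  exact ⟨i, m, h⟩

theorem exists_window {a : Fin n → ℤ}
    (ha : ∀ i j, (n : ℤ) ∣ a i - a j → i = j)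
    (hsum : ∑ i, a i = (n : ℤ) * (n + 1) / 2) : ∃ f : affineSymmetricGroup n, window f = a := by
  let r : Fin n → Fin n × ℤ := fun i => (windowEquiv n).symm (a i)
  have a_eq (i) : a i = (r i).2 * n + (r i).1 + 1 := ((windowEquiv n).apply_symm_apply (a i)).symm
  have residue_inj : Function.Injective fun i => (r i).1 := fun i j h => ha i j
    ⟨(r i).2 - (r j).2, by
      have : (r i).1 = (r j).1 := h
      rw [a_eq, a_eq, this]
      ring⟩
  let σ : Equiv.Perm (Fin n) := Equiv.ofBijective _ (Finite.injective_iff_bijective.1 residue_inj)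
  let f : Equiv.Perm ℤ := ((windowEquiv n).symm.trans
    (Equiv.prodShear σ fun i => Equiv.addRight (r i).2)).trans (windowEquiv n)
  have f_apply (i : Fin n) (m : ℤ) : f (m * n + i + 1) = a i + m * n := by
    have h : (windowEquiv n).symm (m * n + i + 1) = (i, m) :=
      (windowEquiv n).symm_apply_eq.2 (windowEquiv_apply i m).symm
    simp only [f, σ, Equiv.trans_apply, h, Equiv.prodShear_apply, Equiv.ofBijective_apply,
      Equiv.coe_addRight, windowEquiv_apply, a_eq i]
    ring
  have f_window (i : Fin n) : f ((i : ℤ) + 1) = a i := by simpa using f_apply i 0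
  refine ⟨⟨f, fun x => ?_, ?_⟩, funext f_window⟩
  · obtain ⟨⟨i, m⟩, rfl⟩ := (windowEquiv n).surjective x
    rw [windowEquiv_apply, show m * n + i + 1 + n = (m + 1) * n + i + 1 by ring, f_apply, f_apply]
    ring
  · rw [sum_Icc_eq_sum_fin, ← hsum]
    exact sum_congr rfl fun i _ => f_window i

theorem exists_apply_add_one_lt {h : affineSymmetricGroup n} (hne : h ≠ 1) :
    ∃ y : ℤ, h.1 (y + 1) < h.1 y := by
  by_contra! hle
  have hmono : StrictMono h.1 := strictMono_int_of_lt_succ fun y =>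
    (hle y).lt_of_ne fun e => by simpa using h.1.injective e
  have hsucc (y : ℤ) : h.1 (y + 1) = h.1 y + 1 :=
    (hmono.orderIsoOfSurjective h.1 h.1.surjective).map_succ y
  have htranslation (x : ℤ) : h.1 x = x + h.1 0 := by
    simpa [add_comm] using periodic_add_mul (n := 1) (by simpa using hsucc) 0 x
  have hzero : h.1 0 = 0 := by
    have hs := h.2.2
    rw [sum_congr rfl fun x _ => htranslation x, sum_add_distrib, sum_Icc_id] at hs
    simpa [NeZero.ne n] using hs
  refine hne (Subtype.ext (Equiv.ext fun x => ?_))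
  simp [htranslation x, hzero]

end Windows

section ShiCoordinates

variable {n : ℕ}

theorem ediv_eq_ediv_of_abs_sub_le_one {n a b : ℤ} (hn : 0 < n) (ha : ¬ n ∣ a) (hb : ¬ n ∣ b)
    (hab : |b - a| ≤ 1) : b / n = a / n := by
  have hlt := Int.lt_ediv_add_one_mul_self a hn
  have hle := Int.ediv_mul_le a hn.ne'
  have ha' : a / n * n ≠ a := fun h => ha (Dvd.intro_left _ h)
  have hb' : (a / n + 1) * n ≠ b := fun h => hb (Dvd.intro_left _ h)
  rw [abs_le] at hab
  rw [add_mul, one_mul] at hlt hb'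
  rw [Int.ediv_eq_iff_of_pos hn]
  omega

/-- The coordinate `⌊(f(q) - f(p)) / n⌋` of the alcove of `f` with respect to the family of parallel
hyperplanes indexed by `(p, q)`. -/
def shiCoord (f : affineSymmetricGroup n) (p q : Fin n) : ℤ :=
  (window f q - window f p) / n

/-- The properties that characterize the matrices of coordinates `c p q` of the alcoves of type `A`,
namely `c p q = ⌊x q - x p⌋` for real numbers `x p` with pairwise differences outside `ℤ`. -/
structure IsShiMatrix (c : Fin n → Fin n → ℤ) : Prop where
  diag : ∀ i, c i i = 0
  add_swap : ∀ {i j}, i ≠ j → c i j + c j i = -1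
  triangle_le : ∀ i j k, c i j + c j k ≤ c i k
  le_triangle : ∀ i j k, c i k ≤ c i j + c j k + 1

theorem isShiMatrix_shiCoord [NeZero n] (f : affineSymmetricGroup n) :
    IsShiMatrix (shiCoord f) := by
  have hn : (0 : ℤ) < n := mod_cast NeZero.pos n
  have lower (i j) : shiCoord f i j * n ≤ window f j - window f i := Int.ediv_mul_le _ hn.ne'
  have upper (i j) : window f j - window f i < (shiCoord f i j + 1) * n :=
    Int.lt_ediv_add_one_mul_self _ hn
  refine ⟨fun i => by simp [shiCoord], fun {i j} hij => ?_, fun i j k => ?_, fun i j k => ?_⟩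
  · have lower_strict (i j) (hij : i ≠ j) : shiCoord f i j * n < window f j - window f i :=
      (lower i j).lt_of_ne fun h => not_dvd_window_sub f hij ⟨_, h.symm.trans (mul_comm _ _)⟩
    have h1 : shiCoord f i j + shiCoord f j i < 0 := by
      nlinarith [lower_strict i j hij, lower_strict j i hij.symm]
    have h2 : -2 < shiCoord f i j + shiCoord f j i := by
      nlinarith [upper i j, upper j i]
    omega
  · refine Int.le_of_lt_add_one ?_
    nlinarith [lower i j, lower j k, upper i k]
  · refine Int.le_of_lt_add_one ?_
    nlinarith [upper i j, upper j k, lower i k]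

theorem window_adjSwap_mul (hn : 2 ≤ n) (k : Fin n) (f : affineSymmetricGroup n) (p : Fin n) :
    window (adjSwap k * f) p = adjSwapFun n k (window f p) := by
  simp [window, adjSwap, hn]

section AdjSwap

variable {f : affineSymmetricGroup n} {k i j : Fin n}

theorem ne_of_dvd_window_sub (hn : 2 ≤ n) (hi : (n : ℤ) ∣ window f i - k)
    (hj : (n : ℤ) ∣ window f j - (k + 1)) : i ≠ j := by
  rintro rfl
  exact not_dvd_one_of_two_le hn (by simpa using dvd_sub hi hj)

theorem window_adjSwap_mul_eq_ite (hn : 2 ≤ n) (hi : (n : ℤ) ∣ window f i - k)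
    (hj : (n : ℤ) ∣ window f j - (k + 1)) (p : Fin n) :
    window (adjSwap k * f) p =
      window f p + (if p = i then 1 else 0) - (if p = j then 1 else 0) := by
  have dvd_iff {l : Fin n} {y : ℤ} (hl : (n : ℤ) ∣ window f l - y) :
      (n : ℤ) ∣ window f p - y ↔ p = l := by
    refine ⟨fun h => ?_, fun h => h ▸ hl⟩
    by_contra hne
    exact not_dvd_window_sub f hne (by simpa using dvd_sub hl h)
  have hij := ne_of_dvd_window_sub hn hi hj
  rw [window_adjSwap_mul hn, adjSwapFun]
  simp only [dvd_iff hi, dvd_iff hj]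
  split_ifs <;> grind

theorem shiCoord_adjSwap_mul_of_ne (hn : 2 ≤ n) (hi : (n : ℤ) ∣ window f i - k)
    (hj : (n : ℤ) ∣ window f j - (k + 1)) {p q : Fin n} (hpq : p ≠ q)
    (hij : ¬ (p = i ∧ q = j)) (hji : ¬ (p = j ∧ q = i)) :
    shiCoord (adjSwap k * f) p q = shiCoord f p q := by
  refine ediv_eq_ediv_of_abs_sub_le_one (by omega) (not_dvd_window_sub _ hpq)
    (not_dvd_window_sub _ hpq) ?_
  simp only [window_adjSwap_mul_eq_ite hn hi hj]
  rw [abs_le]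
  split_ifs <;> grind

theorem shiCoord_adjSwap_mul_self (hn : 2 ≤ n) (hi : (n : ℤ) ∣ window f i - k)
    (hj : (n : ℤ) ∣ window f j - (k + 1)) :
    shiCoord (adjSwap k * f) i j = shiCoord f i j - 1 := by
  have hij := ne_of_dvd_window_sub hn hi hj
  obtain ⟨m, hm⟩ : (n : ℤ) ∣ window f j - window f i - 1 := by
    have h := dvd_sub hj hi
    ring_nf at h ⊢
    exact h
  have before : shiCoord f i j = m := by
    rw [shiCoord, Int.ediv_eq_iff_of_pos (by omega)]
    constructor <;> linarith
  have after : shiCoord (adjSwap k * f) i j = m - 1 := by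
    rw [shiCoord, Int.ediv_eq_iff_of_pos (by omega)]
    simp only [window_adjSwap_mul_eq_ite hn hi hj, if_neg hij, if_neg hij.symm, if_true]
    constructor <;> linarith
  rw [before, after]

end AdjSwap

theorem exists_shiCoord_lt [NeZero n] {f g : affineSymmetricGroup n} (hfg : f ≠ g) :
    ∃ i j : Fin n, (n : ℤ) ∣ window f j - window f i - 1 ∧ shiCoord g i j < shiCoord f i j := by
  have hn : (0 : ℤ) < n := mod_cast NeZero.pos n
  obtain ⟨y, hy⟩ := exists_apply_add_one_lt fun h : g * f⁻¹ = 1 => hfg (mul_inv_eq_one.1 h).symm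
  obtain ⟨i, a, hi⟩ := exists_window_eq f y
  obtain ⟨j, b, hj⟩ := exists_window_eq f (y + 1)
  have g_desc : window g j + b * n < window g i + a * n := by
    rw [← window_add_mul, ← window_add_mul, ← f.1.symm_apply_eq.2 hi.symm,
      ← f.1.symm_apply_eq.2 hj.symm]
    exact hy
  rw [window_add_mul] at hi hj
  refine ⟨i, j, ⟨a - b, by linarith⟩, ?_⟩
  calc shiCoord g i j < a - b := by rw [shiCoord, Int.ediv_lt_iff_lt_mul hn]; linarith
    _ ≤ shiCoord f i j := by rw [shiCoord, Int.le_ediv_iff_mul_le hn]; linarith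

/-- The coordinates at the pairs `p < q`, which determine the others. -/
def shiVector (f : affineSymmetricGroup n) (t : PairIndex n) : ℤ :=
  shiCoord f t.1.1 t.1.2

@[simp]
theorem shiVector_one : shiVector (1 : affineSymmetricGroup n) = 0 := by
  funext ⟨⟨p, q⟩, hpq⟩
  replace hpq : p < q := hpq
  simp only [shiVector, shiCoord, window, Subgroup.coe_one, Equiv.Perm.one_apply, Pi.zero_apply]
  exact Int.ediv_eq_zero_of_lt (by omega) (by omega)

/-- The number of hyperplanes that separate the alcoves of `f` and `g`. -/
def shiDist (f g : affineSymmetricGroup n) : ℕ :=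
  ∑ t, (shiVector g t - shiVector f t).natAbs

@[simp]
theorem shiDist_self (f : affineSymmetricGroup n) : shiDist f f = 0 := by simp [shiDist]

theorem shiDist_comm (f g : affineSymmetricGroup n) : shiDist f g = shiDist g f :=
  sum_congr rfl fun _ _ => by omega

theorem shiDist_triangle (f g h : affineSymmetricGroup n) :
    shiDist f h ≤ shiDist f g + shiDist g h := by
  simp only [shiDist, ← sum_add_distrib]
  exact sum_le_sum fun t _ => by omega

theorem sum_pairIndex_add_of_symm {M : Type*} [AddCommMonoid M] {D D' : Fin n → Fin n → M}
    (hD : ∀ p q, D p q = D q p) (hD' : ∀ p q, D' p q = D' q p) {i j : Fin n} (hij : i ≠ j)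
    (h : ∀ p q, p ≠ q → ¬ (p = i ∧ q = j) → ¬ (p = j ∧ q = i) → D p q = D' p q) :
    ∑ t : PairIndex n, D t.1.1 t.1.2 + D' i j = ∑ t : PairIndex n, D' t.1.1 t.1.2 + D i j := by
  wlog hlt : i < j generalizing i j
  · rw [hD' i j, hD i j]
    exact this hij.symm (fun p q hpq h1 h2 => h p q hpq h2 h1) (hij.lt_or_gt.resolve_left hlt)
  have h_off (t : PairIndex n) (ht : t ∈ univ.erase ⟨(i, j), hlt⟩) :
      D t.1.1 t.1.2 = D' t.1.1 t.1.2 := by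
    obtain ⟨⟨p, q⟩, hpq⟩ := t
    refine h p q (ne_of_lt hpq) ?_ ?_
    · rintro ⟨rfl, rfl⟩
      simp at ht
    · rintro ⟨rfl, rfl⟩
      exact hlt.not_gt hpq
  rw [← add_sum_erase univ _ (mem_univ ⟨(i, j), hlt⟩), sum_congr rfl h_off,
    ← add_sum_erase univ (fun t : PairIndex n => D' t.1.1 t.1.2) (mem_univ ⟨(i, j), hlt⟩)]
  ac_rfl

theorem shiDist_adjSwap_mul {f : affineSymmetricGroup n} {k i j : Fin n} (hn : 2 ≤ n)
    (hi : (n : ℤ) ∣ window f i - k) (hj : (n : ℤ) ∣ window f j - (k + 1))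
    (g : affineSymmetricGroup n) :
    shiDist (adjSwap k * f) g + (shiCoord g i j - shiCoord f i j).natAbs =
      shiDist f g + (shiCoord g i j - shiCoord f i j + 1).natAbs := by
  have : NeZero n := ⟨by omega⟩
  have natAbs_symm (f g : affineSymmetricGroup n) (p q : Fin n) :
      (shiCoord g p q - shiCoord f p q).natAbs = (shiCoord g q p - shiCoord f q p).natAbs := by
    rcases eq_or_ne p q with rfl | hpq
    · rfl
    · have := (isShiMatrix_shiCoord f).add_swap hpq
      have := (isShiMatrix_shiCoord g).add_swap hpq
      omega
  have h := sum_pairIndex_add_of_symm (natAbs_symm (adjSwap k * f) g) (natAbs_symm f g)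
    (ne_of_dvd_window_sub hn hi hj) fun p q hpq hij hji => by
      rw [shiCoord_adjSwap_mul_of_ne hn hi hj hpq hij hji]
  rwa [shiCoord_adjSwap_mul_self hn hi hj, sub_sub_eq_add_sub, add_sub_right_comm] at h

theorem exists_shiDist_adjSwap_mul_add_one [NeZero n] {f g : affineSymmetricGroup n}
    (hfg : f ≠ g) : ∃ k : Fin n, shiDist (adjSwap k * f) g + 1 = shiDist f g := by
  obtain ⟨i, j, hij, hlt⟩ := exists_shiCoord_lt hfg
  have hne : i ≠ j := by
    rintro rfl
    simp [(isShiMatrix_shiCoord _).diag] at hlt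
  have hn : 2 ≤ n := by omega
  obtain ⟨m, k, hk⟩ := exists_eq_mul_add (n := n) (window f i)
  have hi : (n : ℤ) ∣ window f i - k := ⟨m, by rw [hk]; ring⟩
  have hj : (n : ℤ) ∣ window f j - (k + 1) := by
    have h := dvd_add hij hi
    ring_nf at h ⊢
    exact h
  have := shiDist_adjSwap_mul hn hi hj g
  exact ⟨k, by omega⟩

theorem shiDist_eq_zero [NeZero n] {f g : affineSymmetricGroup n} :
    shiDist f g = 0 ↔ f = g := by
  refine ⟨fun h => ?_, fun h => by simp [h]⟩
  by_contra hfg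
  obtain ⟨k, hk⟩ := exists_shiDist_adjSwap_mul_add_one hfg
  omega

theorem shiDist_adjSwap_mul_le [NeZero n] (k : Fin n) (f : affineSymmetricGroup n) :
    shiDist f (adjSwap k * f) ≤ 1 := by
  by_cases hn : 2 ≤ n
  · have exists_dvd (y : ℤ) : ∃ i, (n : ℤ) ∣ window f i - y := by
      obtain ⟨i, m, h⟩ := exists_window_eq f y
      exact ⟨i, -m, by rw [window_add_mul] at h; linarith⟩
    obtain ⟨i, hi⟩ := exists_dvd k
    obtain ⟨j, hj⟩ := exists_dvd (k + 1)
    have := shiDist_adjSwap_mul hn hi hj f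
    rw [shiDist_comm]
    simp only [sub_self, Int.natAbs_zero, add_zero, shiDist_self, zero_add, isUnit_one,
      Int.natAbs_of_isUnit] at this
    omega
  · simp [adjSwap, hn]

end ShiCoordinates

section CoxeterLength

variable {n : ℕ} [NeZero n]

theorem shiDist_prod_mul_le (w : List (Fin n)) (f : affineSymmetricGroup n) :
    shiDist f ((w.map adjSwap).prod * f) ≤ w.length := by
  induction w with
  | nil => simp
  | cons k w ih =>
    rw [List.map_cons, List.prod_cons, List.length_cons, mul_assoc]
    exact (shiDist_triangle _ _ _).trans (add_le_add ih (shiDist_adjSwap_mul_le k _))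

theorem exists_word_of_shiDist (f g : affineSymmetricGroup n) :
    ∃ w : List (Fin n), w.length = shiDist f g ∧ (w.map adjSwap).prod * f = g := by
  induction hN : shiDist f g generalizing f with
  | zero => exact ⟨[], rfl, by simp [shiDist_eq_zero.1 hN]⟩
  | succ N ih =>
    have hfg : f ≠ g := mt shiDist_eq_zero.2 (by omega)
    obtain ⟨k, hk⟩ := exists_shiDist_adjSwap_mul_add_one hfg
    obtain ⟨w, hw, hprod⟩ := ih (adjSwap k * f) (by omega)
    exact ⟨w ++ [k], by simp [hw], by simpa [mul_assoc] using hprod⟩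

theorem coxeterLength_mul_inv (f g : affineSymmetricGroup n) :
    coxeterLength (g * f⁻¹) = shiDist f g := by
  obtain ⟨w, hw, hprod⟩ := exists_word_of_shiDist f g
  have hmem : ∃ w : List (Fin n), w.length = shiDist f g ∧ (w.map adjSwap).prod = g * f⁻¹ :=
    ⟨w, hw, eq_mul_inv_of_mul_eq hprod⟩
  refine le_antisymm (Nat.sInf_le hmem) (le_csInf ⟨_, hmem⟩ ?_)
  rintro _ ⟨w', rfl, hw'⟩
  simpa [hw'] using shiDist_prod_mul_le w' f

theorem coxeterLength_eq_shiDist (f : affineSymmetricGroup n) :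
    coxeterLength f = shiDist 1 f := by
  simpa using coxeterLength_mul_inv 1 f

theorem coxeterLength_eq_sum (f : affineSymmetricGroup n) :
    coxeterLength f = ∑ t, (shiVector f t).natAbs := by
  simp [coxeterLength_eq_shiDist, shiDist]

theorem shiVector_injective : Function.Injective (shiVector (n := n)) := fun f g h =>
  shiDist_eq_zero.1 (by simp [shiDist, h])

end CoxeterLength

section WeakOrder

variable {n : ℕ}

theorem coxeterLength_of_covBy {f g : affineSymmetricGroup n} (h : f ⋖ g) :
    coxeterLength g = coxeterLength f + 1 := by
  rcases Relation.ReflTransGen.cases_head (show Relation.ReflTransGen LeftWeakCovers f g from h.le)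
    with rfl | ⟨c, hfc, hcg⟩
  · exact absurd h.lt (lt_irrefl _)
  · have hlt : f < c := lt_of_le_of_ne (Relation.ReflTransGen.single hfc) <| by
      rintro rfl
      exact absurd hfc.2 (by omega)
    obtain rfl : c = g := eq_of_le_of_not_lt hcg (h.2 hlt)
    exact hfc.2

variable [NeZero n]

theorem le_iff_shiDist_add_shiDist {f g : affineSymmetricGroup n} :
    f ≤ g ↔ shiDist 1 f + shiDist f g = shiDist 1 g := by
  constructor
  · intro (h : Relation.ReflTransGen LeftWeakCovers f g)
    induction h with
    | refl => simp
    | @tail g _ _ hcov ih =>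
      obtain ⟨⟨k, rfl⟩, hlen⟩ := hcov
      simp only [coxeterLength_eq_shiDist] at hlen
      have := shiDist_triangle 1 f (adjSwap k * g)
      have := shiDist_triangle f g (adjSwap k * g)
      have := shiDist_adjSwap_mul_le k g
      omega
  · induction hN : shiDist f g generalizing f with
    | zero => exact fun _ => (shiDist_eq_zero.1 hN).le
    | succ N ih =>
      intro h
      have hfg : f ≠ g := mt shiDist_eq_zero.2 (by omega)
      obtain ⟨k, hk⟩ := exists_shiDist_adjSwap_mul_add_one hfg
      have := shiDist_triangle 1 f (adjSwap k * f)
      have := shiDist_triangle 1 (adjSwap k * f) g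
      have := shiDist_adjSwap_mul_le k f
      have hcov : LeftWeakCovers f (adjSwap k * f) :=
        ⟨⟨k, rfl⟩, by simp only [coxeterLength_eq_shiDist]; omega⟩
      exact (Relation.ReflTransGen.single hcov).trans (ih (by omega) (by omega))

theorem le_iff_shiVector_mem_uIcc {f g : affineSymmetricGroup n} :
    f ≤ g ↔ ∀ t, shiVector f t ∈ Set.uIcc 0 (shiVector g t) := by
  simp only [le_iff_shiDist_add_shiDist, shiDist, ← sum_add_distrib, shiVector_one, Pi.zero_apply,
    sub_zero]
  rw [eq_comm, sum_eq_sum_iff_of_le fun t _ => by omega]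
  simp only [mem_univ, true_imp_iff, Set.mem_uIcc]
  exact forall_congr' fun t => by omega

theorem one_le_affineSymmetricGroup (f : affineSymmetricGroup n) : 1 ≤ f := by
  simp [le_iff_shiVector_mem_uIcc]

theorem le_iff_shiVector_le {f g : affineSymmetricGroup n} (hg : 0 ≤ shiVector g) :
    f ≤ g ↔ 0 ≤ shiVector f ∧ shiVector f ≤ shiVector g := by
  simp only [le_iff_shiVector_mem_uIcc, Pi.le_def, ← forall_and]
  exact forall_congr' fun t => by
    rw [Set.uIcc_of_le (show 0 ≤ shiVector g t from hg t)]
    rfl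

theorem isRankFunction_coxeterLength_Icc {P : Type*} [PartialOrder P]
    {g : affineSymmetricGroup n} (e : P ≃o Set.Icc (1 : affineSymmetricGroup n) g) :
    IsRankFunction fun x => coxeterLength (e x).1 := by
  constructor
  · intro x hx
    have hmin : IsMin (e x) := (OrderIso.isMin_apply e).2 hx
    have hle : (⟨1, le_rfl, one_le_affineSymmetricGroup g⟩ : Set.Icc 1 g) ≤ e x := (e x).2.1
    have hone : (e x).1 = 1 := le_antisymm (hmin hle) hle
    simp [hone, coxeterLength_eq_shiDist]
  · intro x y hxy
    obtain ⟨hlt, hnot⟩ := (apply_covBy_apply_iff e).2 hxy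
    exact coxeterLength_of_covBy ⟨hlt, fun c hc hcy =>
      @hnot ⟨c, one_le_affineSymmetricGroup c, hcy.le.trans (e y).2.2⟩ hc hcy⟩

end WeakOrder

namespace IsShiMatrix

variable {n : ℕ} {c : Fin n → Fin n → ℤ}

theorem of_lt (diag : ∀ i, c i i = 0) (add_swap : ∀ {i j}, i < j → c i j + c j i = -1)
    (triangle : ∀ i j k, i < j → j < k → c i j + c j k ≤ c i k ∧ c i k ≤ c i j + c j k + 1) :
    IsShiMatrix c := by
  have add_swap' {i j : Fin n} (hij : i ≠ j) : c i j + c j i = -1 := by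
    rcases hij.lt_or_gt with h | h
    · exact add_swap h
    · rw [add_comm, add_swap h]
  have triangle' (i j k : Fin n) : c i j + c j k ≤ c i k ∧ c i k ≤ c i j + c j k + 1 := by
    grind
  exact ⟨diag, add_swap', fun i j k => (triangle' i j k).1, fun i j k => (triangle' i j k).2⟩

theorem sum_natCast_add_sum (hc : IsShiMatrix c) :
    ∑ j, (n + ∑ p, c p j) = (n : ℤ) * (n + 1) / 2 := by
  have add_swap_eq (j p : Fin n) : c p j + c j p = (if p = j then 1 else 0) - 1 := by
    split_ifs with h
    · simp [h, hc.diag]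
    · exact hc.add_swap h
  have two_mul_sum : 2 * ∑ j, ∑ p, c p j = -((n : ℤ) * (n - 1)) :=
    calc 2 * ∑ j, ∑ p, c p j = ∑ j, ∑ p, c p j + ∑ j, ∑ p, c j p := by
          rw [two_mul, sum_comm (f := fun j p => c j p)]
      _ = ∑ j : Fin n, ∑ p : Fin n, ((if p = j then 1 else 0) - 1 : ℤ) := by
          simp only [← sum_add_distrib, add_swap_eq]
      _ = -((n : ℤ) * (n - 1)) := by
          simp only [sum_sub_distrib, sum_ite_eq', mem_univ, ↓reduceIte, sum_const, card_univ,
            Fintype.card_fin, Int.nsmul_eq_mul, mul_one]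
          ring
  rw [sum_add_distrib]
  refine (Int.ediv_eq_of_eq_mul_right two_ne_zero ?_).symm
  simp only [sum_const, card_univ, Fintype.card_fin, nsmul_eq_mul]
  linarith

theorem mul_lt_sum_sub_sum (hc : IsShiMatrix c) {i j : Fin n} (hij : i ≠ j) :
    c i j * n < ∑ p, c p j - ∑ p, c p i := by
  have hlt : ∑ _p : Fin n, c i j < ∑ p, (c p j - c p i) :=
    sum_lt_sum (fun p _ => by linarith [hc.triangle_le p i j])
      ⟨j, mem_univ _, by linarith [hc.diag j, hc.add_swap hij]⟩
  simpa [mul_comm] using hlt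

theorem sum_sub_sum_lt (hc : IsShiMatrix c) (i j : Fin n) :
    ∑ p, c p j - ∑ p, c p i < (c i j + 1) * n := by
  have hlt : ∑ p, (c p j - c p i) < ∑ _p : Fin n, (c i j + 1) :=
    sum_lt_sum (fun p _ => by linarith [hc.le_triangle p i j])
      ⟨i, mem_univ _, by linarith [hc.diag i]⟩
  simpa [mul_comm] using hlt

-- The column sums recover the coordinates because each `c p j - c p i - c i j` is `0` or `1`.
theorem exists_shiCoord_eq [NeZero n] (hc : IsShiMatrix c) :
    ∃ f : affineSymmetricGroup n, shiCoord f = c ∧ ∀ j, window f j = n + ∑ p, c p j := by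
  have hn : (0 : ℤ) < n := mod_cast NeZero.pos n
  have incongruent (j i : Fin n) (h : (n : ℤ) ∣ (n + ∑ p, c p j) - (n + ∑ p, c p i)) :
      j = i := by
    by_contra hne
    obtain ⟨m, hm⟩ := h
    have hlt := hc.mul_lt_sum_sub_sum (Ne.symm hne)
    have hlt' := hc.sum_sub_sum_lt i j
    have : c i j < m := by nlinarith
    have : m < c i j + 1 := by nlinarith
    omega
  obtain ⟨f, hf⟩ := exists_window incongruent hc.sum_natCast_add_sum
  refine ⟨f, funext fun i => funext fun j => ?_, fun j => by rw [hf]⟩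
  rcases eq_or_ne i j with rfl | hij
  · simp [shiCoord, hc.diag]
  · rw [shiCoord, hf, Int.ediv_eq_iff_of_pos hn]
    have := hc.mul_lt_sum_sub_sum hij
    have := hc.sum_sub_sum_lt i j
    constructor <;> linarith

end IsShiMatrix

section AdmittedVector

variable {n : ℕ}

/-- The extension of a vector `v ∈ ℕ^T` to a matrix with zero diagonal and `v_{ij} + v_{ji} = -1`
for `i ≠ j`, as satisfied by the coordinates of an alcove. -/
def extendCoord (v : PairIndex n → ℕ) (i j : Fin n) : ℤ :=
  if h : i < j then coord v i j h else if h : j < i then -(coord v j i h : ℤ) - 1 else 0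

theorem extendCoord_of_lt (v : PairIndex n → ℕ) {i j : Fin n} (h : i < j) :
    extendCoord v i j = coord v i j h := dif_pos h

theorem extendCoord_of_gt (v : PairIndex n → ℕ) {i j : Fin n} (h : j < i) :
    extendCoord v i j = -(coord v j i h : ℤ) - 1 :=
  (dif_neg h.not_gt).trans (dif_pos h)

theorem extendCoord_self (v : PairIndex n → ℕ) (i : Fin n) : extendCoord v i i = 0 := by
  simp [extendCoord]

theorem isShiMatrix_extendCoord {v : PairIndex n → ℕ} (hv : IsAdmitted v) :
    IsShiMatrix (extendCoord v) := by
  refine .of_lt (extendCoord_self v) (fun {i j} hij => ?_) fun i j k hij hjk => ?_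
  · rw [extendCoord_of_lt v hij, extendCoord_of_gt v hij]
    ring
  · rw [extendCoord_of_lt v hij, extendCoord_of_lt v hjk, extendCoord_of_lt v (hij.trans hjk)]
    exact_mod_cast hv.2 i j k hij hjk

theorem windowMap_eq (v : PairIndex n → ℕ) (i : Fin n) :
    windowMap v i = n + ∑ p, extendCoord v p i := by
  have sum_split : ∑ p, extendCoord v p i =
      ∑ p : {p : Fin n // p < i}, extendCoord v p i +
        ∑ p : {p : Fin n // i < p}, extendCoord v p i := by
    rw [← sum_subtype (univ.filter (· < i)) (by simp) fun p => extendCoord v p i,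
      ← sum_subtype (univ.filter (i < ·)) (by simp) fun p => extendCoord v p i,
      sum_filter, sum_filter, ← sum_add_distrib]
    refine sum_congr rfl fun p _ => ?_
    rcases lt_trichotomy p i with h | rfl | h
    · simp [h, h.not_gt]
    · simp [extendCoord_self]
    · simp [h, h.not_gt]
  have card_gt : (Fintype.card {p : Fin n // i < p} : ℤ) = n - 1 - i := by
    rw [Fintype.card_subtype, filter_lt_eq_Ioi, Fin.card_Ioi]
    omega
  have sum_gt : ∑ p : {p : Fin n // i < p}, extendCoord v p i =
      -∑ p : {p : Fin n // i < p}, (coord v i p.1 p.2 : ℤ) - (n - 1 - i) := by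
    rw [sum_congr rfl fun p _ => extendCoord_of_gt v p.2, sum_sub_distrib, sum_neg_distrib,
      sum_const, card_univ, nsmul_eq_mul, mul_one, card_gt]
  rw [sum_split, sum_congr rfl fun p _ => extendCoord_of_lt v p.2, sum_gt, windowMap]
  ring

theorem isAdmitted_sub_sub_one : IsAdmitted fun t : PairIndex n => (t.1.2 - t.1.1 - 1 : ℕ) :=
  ⟨fun i j h hij => by simp only [coord]; omega,
    fun i j k hij hjk => by
      rw [Fin.lt_def] at hij hjk
      simp only [coord]
      omega⟩

theorem coord_le_of_isAdmitted {v : PairIndex n → ℕ} (hv : IsAdmitted v) {i j : Fin n}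
    (h : i < j) : coord v i j h ≤ (j : ℕ) - i - 1 := by
  obtain ⟨d, hd⟩ := Nat.exists_eq_add_of_lt (Fin.lt_def.1 h)
  induction d generalizing j with
  | zero => rw [hv.1 i j h (by omega)]; omega
  | succ d ih =>
    let l : Fin n := ⟨i + d + 1, by omega⟩
    have hil : i < l := Fin.lt_def.2 (by simp only [l]; omega)
    have hlj : l < j := Fin.lt_def.2 (by simp only [l]; omega)
    calc coord v i j h ≤ coord v i l hil + coord v l j hlj + 1 := (hv.2 i l j hil hlj).2
      _ = coord v i l hil + 1 := by rw [hv.1 l j hlj (by simp only [l]; omega)]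
      _ ≤ (l : ℕ) - i - 1 + 1 := by gcongr; exact ih hil rfl
      _ = (j : ℕ) - i - 1 := by simp only [l]; omega

instance : OrderTop (AdmittedVector n) where
  top := ⟨_, isAdmitted_sub_sub_one⟩
  le_top v := fun t => coord_le_of_isAdmitted v.2 t.2

theorem admittedVector_top_apply (t : PairIndex n) :
    (⊤ : AdmittedVector n).1 t = t.1.2 - t.1.1 - 1 := rfl

end AdmittedVector

section AffinePerm

variable {n : ℕ}

theorem exists_affinePerm [NeZero n] (v : AdmittedVector n) :
    ∃ f : affineSymmetricGroup n, (∀ t, shiVector f t = v.1 t) ∧ window f = windowMap v.1 := by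
  obtain ⟨f, hcoord, hwindow⟩ := (isShiMatrix_extendCoord v.2).exists_shiCoord_eq
  refine ⟨f, fun t => ?_, funext fun j => by rw [hwindow, windowMap_eq]⟩
  rw [shiVector, hcoord, extendCoord_of_lt v.1 t.2]
  rfl

/-- The affine permutation `F(v)` with window `windowMap v`. -/
noncomputable def affinePerm [NeZero n] (v : AdmittedVector n) : affineSymmetricGroup n :=
  (exists_affinePerm v).choose

variable [NeZero n]

theorem shiVector_affinePerm (v : AdmittedVector n) (t : PairIndex n) :
    shiVector (affinePerm v) t = v.1 t :=
  (exists_affinePerm v).choose_spec.1 t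

theorem window_affinePerm (v : AdmittedVector n) : window (affinePerm v) = windowMap v.1 :=
  (exists_affinePerm v).choose_spec.2

theorem coxeterLength_affinePerm (v : AdmittedVector n) :
    coxeterLength (affinePerm v) = ∑ t, v.1 t := by
  simp [coxeterLength_eq_sum, shiVector_affinePerm]

theorem affinePerm_le_affinePerm {v w : AdmittedVector n} :
    affinePerm v ≤ affinePerm w ↔ v ≤ w := by
  rw [le_iff_shiVector_le fun t => by simp [shiVector_affinePerm]]
  simp only [Pi.le_def, shiVector_affinePerm, Pi.zero_apply, Nat.cast_nonneg, implies_true,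
    true_and, Nat.cast_le]
  rfl

theorem affinePerm_injective : Function.Injective (affinePerm (n := n)) :=
  fun _ _ h => le_antisymm (affinePerm_le_affinePerm.1 h.le) (affinePerm_le_affinePerm.1 h.ge)

theorem exists_affinePerm_eq {f : affineSymmetricGroup n} (hf : f ≤ affinePerm ⊤) :
    ∃ v, affinePerm v = f := by
  rw [le_iff_shiVector_le fun t => by simp [shiVector_affinePerm]] at hf
  obtain ⟨nonneg, le_top⟩ := hf
  have cast_toNat {i j : Fin n} (h : i < j) :
      ((shiVector f ⟨(i, j), h⟩).toNat : ℤ) = shiCoord f i j := Int.toNat_of_nonneg (nonneg _)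
  have admitted : IsAdmitted fun t => (shiVector f t).toNat := by
    refine ⟨fun i j h hij => ?_, fun i j k hij hjk => ?_⟩
    · have := le_top ⟨(i, j), h⟩
      simp only [shiVector_affinePerm, admittedVector_top_apply, hij] at this
      simp only [coord]
      omega
    · have := (isShiMatrix_shiCoord f).triangle_le i j k
      have := (isShiMatrix_shiCoord f).le_triangle i j k
      have := cast_toNat hij
      have := cast_toNat hjk
      have := cast_toNat (hij.trans hjk)
      simp only [coord]
      omega
  refine ⟨⟨_, admitted⟩, shiVector_injective (funext fun t => ?_)⟩
  rw [shiVector_affinePerm]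
  exact cast_toNat t.2

/-- The isomorphism `v ↦ F(v)` from the poset of admitted vectors onto a weak order interval. -/
noncomputable def affinePermOrderIso :
    AdmittedVector n ≃o Set.Icc (1 : affineSymmetricGroup n) (affinePerm ⊤) where
  toEquiv := Equiv.ofBijective
    (fun v => ⟨affinePerm v, one_le_affineSymmetricGroup _, affinePerm_le_affinePerm.2 le_top⟩)
    ⟨fun _ _ h => affinePerm_injective (congrArg Subtype.val h),
      fun f => (exists_affinePerm_eq f.2.2).imp fun _ => Subtype.ext⟩
  map_rel_iff' := affinePerm_le_affinePerm

theorem cSeq_eq (n i : ℕ) : cSeq n i = -((n : ℤ) * (n - 3) / 2) + i * (n - 1) := by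
  induction i with
  | zero => simp [cSeq]
  | succ i ih =>
    rw [cSeq, ih]
    push_cast
    ring

theorem window_affinePerm_top (i : Fin n) :
    window (affinePerm (⊤ : AdmittedVector n)) i = cSeq n i := by
  have entry (p : Fin n) : extendCoord (⊤ : AdmittedVector n).1 p i =
      i - p - if p < i then 1 else 0 := by
    rcases lt_trichotomy p i with h | rfl | h
    · rw [extendCoord_of_lt _ h, coord, admittedVector_top_apply, if_pos h]
      rw [Fin.lt_def] at h
      simp only
      omega
    · simp [extendCoord_self]
    · rw [extendCoord_of_gt _ h, coord, admittedVector_top_apply, if_neg h.not_gt]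
      rw [Fin.lt_def] at h
      simp only
      omega
  have gauss : (∑ p : Fin n, (p : ℤ)) * 2 = n * (n - 1) := by
    have h := sum_range_id_mul_two n
    zify [NeZero.one_le] at h
    rwa [← Fin.sum_univ_eq_sum_range (fun p => (p : ℤ))] at h
  rw [window_affinePerm, windowMap_eq, cSeq_eq]
  simp only [entry, sum_sub_distrib, sum_boole, filter_gt_eq_Iio, Fin.card_Iio, sum_const,
    card_univ, Fintype.card_fin, nsmul_eq_mul]
  have hdiv : (n : ℤ) * (n - 3) / 2 = ∑ p : Fin n, (p : ℤ) - n :=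
    Int.ediv_eq_of_eq_mul_right two_ne_zero (by linarith)
  rw [hdiv]
  ring

end AffinePerm

theorem theorem5p1 (n : ℕ) (hn : 1 ≤ n) :
    ∃ fc : affineSymmetricGroup n, (∀ i : Fin n, window fc i = cSeq n i) ∧
      ∃ Φ : AdmittedVector n ≃o Set.Icc (1 : affineSymmetricGroup n) fc,
        (∀ v : AdmittedVector n, window (Φ v).1 = windowMap v.1) ∧
        IsRankFunction (fun v : AdmittedVector n => coxeterLength (Φ v).1) ∧
        ∀ v : AdmittedVector n, coxeterLength (Φ v).1 = ∑ t : PairIndex n, v.1 t := by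
  have : NeZero n := ⟨by omega⟩
  exact ⟨affinePerm ⊤, window_affinePerm_top, affinePermOrderIso, window_affinePerm,
    isRankFunction_coxeterLength_Icc _, fun v => coxeterLength_affinePerm v⟩
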